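/- Let $H(\mathbb{C})$ be the space of entire functions with the topology of local uniform convergence. For $b\in\mathbb{C}$ let $T_b:H(\mathbb{C})\to H(\mathbb{C})$, $T_bf(z)=f(z+b)$, and for a sequence $(T_n)$ of continuous linear operators on $H(\mathbb{C})$ let $HC(\{T_n\})$ be the set of all $f\in H(\mathbb{C})$ such that $\{T_nf : n\in\mathbb{N}\}$ is dense in $H(\mathbb{C})$. Let $\Lambda=(\lambda_n)$ be a sequence of non-zero complex numbers such that $\lambda_n\to\infty$ and $i(\Lambda)=1$, where $$i(\Lambda):=\inf\Big\{a\in\mathbb{R}\cup\{+\infty\} : \text{there is a subsequence } (\mu_n) \text{ of } (\lambda_n) \text{ with } a=\limsup_{n\to\infty}\Big|\frac{\mu_{n+1}}{\mu_n}\Big|\Big\}.$$ Then $\bigcap_{a\in\mathbb{C}\setminus\{0\}}HC(\{T_{\lambda_na}\})$ is a $G_\delta$ and dense subset of $H(\mathbb{C})$. In particular, there exists $f\in H(\mathbb{C})$ such that for every $a\in\mathbb{C}\setminus\{0\}$ the set $\{f(z+\lambda_na) : n\in\mathbb{N}\}$ is dense in $H(\mathbb{C})$. -/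

import Mathlib

open Filter Topology Bornology

/-- The space `H(ℂ)` of entire functions, as a linear subspace of `C(ℂ, ℂ)`. Its topology is the one
induced by the compact-open topology of `C(ℂ, ℂ)`, which is the topology of local uniform
convergence. -/
def EntireFunctions : Submodule ℂ C(ℂ, ℂ) where
  carrier := {f | Differentiable ℂ f}
  add_mem' := fun hf hg => Differentiable.add hf hg
  zero_mem' := differentiable_const 0
  smul_mem' := fun c _ hf => Differentiable.const_smul hf c

/-- The translation operator `T_a f (z) = f (z + a)`, a continuous linear operator on `H(ℂ)`. -/
noncomputable def translationOp (a : ℂ) : EntireFunctions →L[ℂ] EntireFunctions where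
  toFun f := ⟨f.1.comp ⟨fun z => z + a, by fun_prop⟩,
    Differentiable.comp (𝕜 := ℂ) (g := f.1) (f := fun z => z + a) f.2
      (differentiable_id.add_const a)⟩
  map_add' _ _ := rfl
  map_smul' _ _ := rfl
  cont := Continuous.subtype_mk
    ((ContinuousMap.continuous_precomp _).comp continuous_subtype_val) _

/-- The set `HC({T_n})` of hypercyclic vectors of a sequence of continuous linear operators: the
vectors whose orbit `{T_n x : n}` is dense. -/
def HC {X : Type*} [AddCommMonoid X] [Module ℂ X] [TopologicalSpace X] (T : ℕ → X →L[ℂ] X) :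
    Set X :=
  {x | closure {y | ∃ n, y = T n x} = Set.univ}

/-- `i(Λ)`: the infimum, over all subsequences `(μ_n)` of `(l_n)`, of
`limsup |μ_{n+1} / μ_n|`, computed in the extended reals. -/
noncomputable def ratioIndex (l : ℕ → ℂ) : EReal :=
  sInf {a : EReal | ∃ φ : ℕ → ℕ, StrictMono φ ∧
    a = limsup (fun n => ((‖l (φ (n + 1)) / l (φ n)‖ : ℝ) : EReal)) atTop}

/-!
# Common hypercyclic translations along sequences of index one

For a nonempty open set `V` of entire functions, let `visiting l S V` be the set of `f` such that,
for every `a ∈ S`, some translate `f (· + l n * a)` lies in `V`. The set of common hypercyclic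
functions is the intersection of the sets `visiting l {a | a ≠ 0} V`, with `V` in a countable
basis. Since `H(ℂ)` is a Baire space, since `visiting l S V` is open for compact `S`
(`isOpen_visiting`), and since countably many small discs cover `ℂ \ {0}`, it is enough to find
around each `a₀ ≠ 0` a disc `S`, depending on `V`, with `visiting l S V` dense
(`exists_dense_visiting`).

For this, a given function `g` has to be approximated on a large disc around `0`, and copies
`h (· - w)` of a target `h ∈ V` on discs of a fixed radius around finitely many centres `w`, such
that every `a ∈ S` has some `l n * a` close to some `w`. A function approximating all of these
exists as soon as the discs are disjoint (`exists_entire_approx`): their union `K` then has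
connected complement, so by spectral permanence the coordinate function has the same spectrum `K`
in the uniform closure of the entire functions on `K` as in `C(K, ℂ)`; hence this closure contains
the reciprocals of polynomials without zeros on `K`, and through them the indicator function of
each disc.

The centres come from `exists_covering`. As `i(Λ) = 1`, the moduli `|l n|` meet every interval
`[x, (1 + ε) x]` with `x` large (`exists_norm_mem_Icc_of_ratioIndex`). Take a lattice in the
parameter plane with spacing a small multiple of `1 / x`, so that `l n * a` is close to `l n` times
a lattice point whenever `|l n| ≤ 2 x`. The images of all lattice points under a single `l n` would
be too close together, but those of a single congruence class modulo a fixed `m` are not. So one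
picks `m ^ 2` terms `l n` with slightly different moduli between `x` and `2 x`, one for each class.
If `S` is small, the annuli containing the images of the classes are disjoint, at distances
growing with `x`.
-/

/-! ### Complements of disjoint closed balls -/

lemma isPreconnected_annulus (w : ℂ) (r R : ℝ) (hr : 0 ≤ r) :
    IsPreconnected {z : ℂ | r < ‖z - w‖ ∧ ‖z - w‖ < R} := by
  have h : {z : ℂ | r < ‖z - w‖ ∧ ‖z - w‖ < R} =
      (fun p : ℝ × ℝ => w + p.1 * Complex.exp (p.2 * Complex.I)) '' (Set.Ioo r R ×ˢ Set.univ) := by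
    ext z
    simp only [Set.mem_ofPred_eq, Set.mem_image, Set.mem_prod, Set.mem_Ioo, Set.mem_univ, and_true,
      Prod.exists]
    constructor
    · intro hz
      refine ⟨‖z - w‖, (z - w).arg, hz, ?_⟩
      rw [Complex.norm_mul_exp_arg_mul_I]; ring
    · rintro ⟨s, t, hs, rfl⟩
      simpa [Complex.norm_exp_ofReal_mul_I, abs_of_pos (hr.trans_lt hs.1)] using hs
  rw [h]
  refine IsPreconnected.image (isPreconnected_Ioo.prod isPreconnected_univ) _ ?_
  fun_prop

/-- Removing a closed disc, together with some margin contained in a connected open set, leaves the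
set connected: the surrounding annulus is connected, so it cannot be cut by a separation. -/
lemma isPreconnected_diff_closedBall {U : Set ℂ} (hUo : IsOpen U) (hU : IsPreconnected U)
    {w : ℂ} {r R : ℝ} (hr : 0 ≤ r) (hrR : r < R) (hball : Metric.ball w R ⊆ U) :
    IsPreconnected (U \ Metric.closedBall w r) := by
  have hann := isPreconnected_annulus w r R hr
  have hannU : {z : ℂ | r < ‖z - w‖ ∧ ‖z - w‖ < R} ⊆ U \ Metric.closedBall w r := by
    rintro z ⟨h1, h2⟩
    exact ⟨hball (by simpa [dist_eq_norm] using h2), by simpa [dist_eq_norm] using h1⟩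
  have hso : IsOpen (U \ Metric.closedBall w r) := hUo.sdiff Metric.isClosed_closedBall
  -- If `A` and `B` separate `U \ closedBall w r` and `A` contains the annulus, then
  -- `A ∪ ball w R` and `B` separate `U`.
  have key : ∀ A B : Set ℂ, IsOpen A → IsOpen B → B ⊆ U \ Metric.closedBall w r →
      U \ Metric.closedBall w r ⊆ A ∪ B → Disjoint A B →
      {z : ℂ | r < ‖z - w‖ ∧ ‖z - w‖ < R} ⊆ A → B.Nonempty → False := by
    rintro A B hA hB hBs hcov hdis hsub ⟨b, hb⟩
    have hw : w ∈ Metric.ball w R := Metric.mem_ball_self (hr.trans_lt hrR)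
    obtain ⟨z, -, hz1, hz2⟩ := hU (A ∪ Metric.ball w R) B (hA.union Metric.isOpen_ball) hB
      (fun z hz => by
        by_cases hzb : z ∈ Metric.ball w R
        · exact Or.inl (Or.inr hzb)
        · have : z ∉ Metric.closedBall w r := fun h =>
            hzb (Metric.closedBall_subset_ball hrR h)
          exact (hcov ⟨hz, this⟩).imp Or.inl id)
      ⟨w, hball hw, Or.inr hw⟩ ⟨b, (hBs hb).1, hb⟩
    refine Set.disjoint_left.1 hdis (hz1.elim id fun h => hsub ⟨?_, ?_⟩) hz2
    · simpa [dist_eq_norm] using (hBs hz2).2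
    · simpa [dist_eq_norm] using h
  intro u v hu hv hcov hun hvn
  by_contra hempty
  rw [Set.not_nonempty_iff_eq_empty] at hempty
  set s := U \ Metric.closedBall w r with hs
  have hdis : Disjoint (s ∩ u) (s ∩ v) := by
    rw [Set.disjoint_left]
    rintro z ⟨hz, hzu⟩ ⟨-, hzv⟩
    exact (Set.eq_empty_iff_forall_notMem.1 hempty z) ⟨hz, hzu, hzv⟩
  have hcov' : s ⊆ (s ∩ u) ∪ (s ∩ v) := fun z hz => (hcov hz).imp (⟨hz, ·⟩) (⟨hz, ·⟩)
  rcases IsPreconnected.subset_or_subset (hso.inter hu) (hso.inter hv) hdis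
    (hannU.trans hcov') hann with h | h
  · exact key _ _ (hso.inter hu) (hso.inter hv) Set.inter_subset_left hcov' hdis h hvn
  · exact key _ _ (hso.inter hv) (hso.inter hu) Set.inter_subset_left
      (hcov'.trans (Set.union_comm _ _).subset) hdis.symm h hun

lemma isPreconnected_compl_biUnion_closedBall {ι : Type*} (s : Finset ι) (w : ι → ℂ) (r : ι → ℝ)
    (hr : ∀ i, 0 ≤ r i) (hd : ∀ i j, i ≠ j → r i + r j < dist (w i) (w j)) :
    IsPreconnected (⋃ i ∈ s, Metric.closedBall (w i) (r i))ᶜ := by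
  classical
  induction s using Finset.induction_on with
  | empty => simpa using isPreconnected_univ
  | insert i s hi ih =>
    have hclosed : IsClosed (⋃ j ∈ s, Metric.closedBall (w j) (r j)) :=
      s.finite_toSet.isClosed_biUnion fun _ _ => Metric.isClosed_closedBall
    have hsub : Metric.closedBall (w i) (r i) ⊆ (⋃ j ∈ s, Metric.closedBall (w j) (r j))ᶜ := by
      intro z hz hz'
      simp only [Set.mem_iUnion] at hz'
      obtain ⟨j, hj, hzj⟩ := hz'
      have hij : i ≠ j := fun h => hi (h ▸ hj)
      have := dist_triangle_left (w i) (w j) z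
      have h1 : dist z (w i) ≤ r i := hz
      have h2 : dist z (w j) ≤ r j := hzj
      linarith [hd i j hij]
    obtain ⟨δ, hδ, hthick⟩ := (isCompact_closedBall (w i) (r i)).exists_thickening_subset_open
      hclosed.isOpen_compl hsub
    rw [thickening_closedBall hδ (hr i)] at hthick
    have := isPreconnected_diff_closedBall hclosed.isOpen_compl ih (hr i)
      (show r i < δ + r i by linarith) hthick
    rw [Finset.set_biUnion_insert, Set.compl_union, Set.inter_comm]
    exact this

/-! ### Simultaneous approximation on disjoint discs -/

/-- The algebra of restrictions of entire functions to `K`. -/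
def entireRestrictions (K : Set ℂ) : Subalgebra ℂ C(K, ℂ) where
  carrier := {φ | ∃ f : ℂ → ℂ, Differentiable ℂ f ∧ ∀ x : K, φ x = f x}
  mul_mem' := by
    rintro _ _ ⟨f, hf, hf'⟩ ⟨g, hg, hg'⟩
    exact ⟨f * g, hf.mul hg, fun x => by simp [hf', hg']⟩
  add_mem' := by
    rintro _ _ ⟨f, hf, hf'⟩ ⟨g, hg, hg'⟩
    exact ⟨f + g, hf.add hg, fun x => by simp [hf', hg']⟩
  algebraMap_mem' c := ⟨fun _ => c, differentiable_const c, fun x => by simp⟩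

/-- If the complement of `K` is connected, the reciprocal of a polynomial without zeros on `K` is a
uniform limit on `K` of entire functions: by spectral permanence, the coordinate function has
spectrum `K` in the closure of the entire functions. -/
lemma exists_inv_mem_topologicalClosure {K : Set ℂ} [CompactSpace K] (hK : IsPreconnected Kᶜ)
    (hne : K.Nonempty) (p : Polynomial ℂ) (hp : ∀ z ∈ K, p.eval z ≠ 0) :
    ∃ φ ∈ (entireRestrictions K).topologicalClosure, ∀ x : K, φ x = (p.eval (x : ℂ))⁻¹ := by
  have hcl : IsClosed ((entireRestrictions K).topologicalClosure : Set C(K, ℂ)) :=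
    Subalgebra.isClosed_topologicalClosure _
  let Z : (entireRestrictions K).topologicalClosure :=
    ⟨⟨fun x => x, continuous_subtype_val⟩, Subalgebra.le_topologicalClosure _
      ⟨id, differentiable_id, fun _ => rfl⟩⟩
  have hspec' : spectrum ℂ (Z : C(K, ℂ)) = K := by
    rw [ContinuousMap.spectrum_eq_range]
    exact Subtype.range_coe
  have hspec : spectrum ℂ Z = K := by
    rw [Subalgebra.spectrum_eq_of_isPreconnected_compl _ Z (by rw [hspec']; exact hK), hspec']
  have hunit : IsUnit (Polynomial.aeval Z p) := by
    rw [← spectrum.zero_notMem_iff ℂ, spectrum.map_polynomial_aeval_of_nonempty _ _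
      (by rw [hspec]; exact hne), hspec]
    rintro ⟨z, hz, h0⟩
    exact hp z hz h0
  obtain ⟨u, hu⟩ := hunit
  refine ⟨((u⁻¹ : _ˣ) : (entireRestrictions K).topologicalClosure), Subtype.property _,
    fun x => ?_⟩
  let ev : (entireRestrictions K).topologicalClosure →ₐ[ℂ] ℂ :=
    (ContinuousMap.evalAlgHom ℂ ℂ x).comp (Subalgebra.val _)
  have h1 : ev (Polynomial.aeval Z p) = p.eval (x : ℂ) := by
    rw [← Polynomial.aeval_algHom_apply, Polynomial.coe_aeval_eq_eval]
    rfl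
  have h2 : ev ((u⁻¹ : _ˣ) : (entireRestrictions K).topologicalClosure) * p.eval (x : ℂ) = 1 := by
    rw [← h1, ← hu, ← map_mul, Units.inv_mul, map_one]
  exact eq_inv_of_mul_eq_one_left h2

section Discs

variable {ι : Type*} [Fintype ι] {w : ι → ℂ} {r : ι → ℝ}

lemma isCompact_iUnion_closedBall (w : ι → ℂ) (r : ι → ℝ) :
    IsCompact (⋃ i, Metric.closedBall (w i) (r i)) :=
  isCompact_iUnion fun _ => isCompact_closedBall _ _

/-- The indicator function of one disc of a finite disjoint family is approximable: the functions
`1 / (1 + ((z - w i) / ρ) ^ n)`, with `ρ` slightly larger than `r i`, have their poles on a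
circle that avoids all the discs, and tend to `1` inside this circle and to `0` outside. -/
lemma exists_approx_indicator (hr : ∀ i, 0 ≤ r i)
    (hd : ∀ i j, i ≠ j → r i + r j < dist (w i) (w j)) (i : ι) {ε : ℝ} (hε : 0 < ε)
    [CompactSpace (⋃ i, Metric.closedBall (w i) (r i) : Set ℂ)] :
    ∃ φ ∈ (entireRestrictions (⋃ i, Metric.closedBall (w i) (r i))).topologicalClosure,
      ∀ x : (⋃ i, Metric.closedBall (w i) (r i) : Set ℂ),
        ((x : ℂ) ∈ Metric.closedBall (w i) (r i) → ‖φ x - 1‖ ≤ ε) ∧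
        (∀ j, j ≠ i → (x : ℂ) ∈ Metric.closedBall (w j) (r j) → ‖φ x‖ ≤ ε) := by
  obtain ⟨δ, hδ, hδd⟩ : ∃ δ > 0, ∀ j, j ≠ i → r i + r j + 2 * δ < dist (w i) (w j) := by
    have h : ∀ᶠ δ in 𝓝[>] (0 : ℝ), ∀ j, j ≠ i → r i + r j + 2 * δ < dist (w i) (w j) := by
      refine eventually_all.2 fun j => ?_
      by_cases hj : j = i
      · simp [hj]
      · have : Tendsto (fun δ : ℝ => r i + r j + 2 * δ) (𝓝[>] 0) (𝓝 (r i + r j + 2 * 0)) :=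
          (Continuous.tendsto (by fun_prop) _).mono_left nhdsWithin_le_nhds
        filter_upwards [this.eventually_lt_const (by simpa using hd i j (Ne.symm hj))] with δ h _
        exact h
    obtain ⟨δ, h1, h2⟩ := (h.and self_mem_nhdsWithin).exists
    exact ⟨δ, h2, h1⟩
  have hri := hr i
  set ρ := r i + δ with hρ
  have hρ0 : 0 < ρ := by positivity
  set q := ρ / (ρ + δ) with hq
  have hq0 : 0 < q := by positivity
  have hq1 : q < 1 := (div_lt_one (by positivity)).2 (by linarith)
  obtain ⟨n, hn⟩ := exists_pow_lt_of_lt_one (show 0 < ε / (1 + ε) by positivity) hq1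
  have hn0 : 0 < q ^ n := by positivity
  have hn1 : q ^ n < 1 := hn.trans ((div_lt_one (by positivity)).2 (by linarith))
  have hnε : q ^ n ≤ ε * (1 - q ^ n) := by
    rw [lt_div_iff₀ (by positivity)] at hn
    linarith
  -- the size of the rational function inside and outside the circle of poles
  have hin : ∀ z ∈ Metric.closedBall (w i) (r i), ‖((ρ : ℂ)⁻¹ * (z - w i)) ^ n‖ ≤ q ^ n := by
    intro z hz
    rw [norm_pow]
    refine pow_le_pow_left₀ (norm_nonneg _) ?_ n
    rw [mem_closedBall_iff_norm] at hz
    rw [norm_mul, norm_inv, Complex.norm_real, Real.norm_of_nonneg hρ0.le, hq,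
      inv_mul_le_iff₀ hρ0, ← mul_div_assoc, le_div_iff₀ (by positivity)]
    have h1 : ‖z - w i‖ * (ρ + δ) ≤ r i * (ρ + δ) := by gcongr
    have h2 : r i * (ρ + δ) ≤ ρ * ρ := by rw [hρ]; nlinarith
    exact h1.trans h2
  have hout : ∀ j, j ≠ i → ∀ z ∈ Metric.closedBall (w j) (r j),
      (q ^ n)⁻¹ ≤ ‖((ρ : ℂ)⁻¹ * (z - w i)) ^ n‖ := by
    intro j hj z hz
    rw [norm_pow, ← inv_pow]
    refine pow_le_pow_left₀ (by positivity) ?_ n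
    have hz' : dist z (w j) ≤ r j := hz
    have := dist_triangle_left (w i) (w j) z
    have hzi : ρ + δ ≤ ‖z - w i‖ := by
      rw [← dist_eq_norm]; linarith [hδd j hj]
    rw [norm_mul, norm_inv, Complex.norm_real, Real.norm_of_nonneg hρ0.le, hq, inv_div,
      div_eq_inv_mul]
    gcongr
  let p : Polynomial ℂ := 1 + (Polynomial.C (ρ : ℂ)⁻¹ * (Polynomial.X - Polynomial.C (w i))) ^ n
  have hp : ∀ z, p.eval z = 1 + ((ρ : ℂ)⁻¹ * (z - w i)) ^ n := fun z => by simp [p]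
  have hpin : ∀ z ∈ Metric.closedBall (w i) (r i), 1 - q ^ n ≤ ‖p.eval z‖ := by
    intro z hz
    rw [hp]
    have := norm_sub_le_norm_add (1 : ℂ) (((ρ : ℂ)⁻¹ * (z - w i)) ^ n)
    rw [norm_one] at this
    linarith [hin z hz]
  have hpout : ∀ j, j ≠ i → ∀ z ∈ Metric.closedBall (w j) (r j),
      (1 - q ^ n) / q ^ n ≤ ‖p.eval z‖ := by
    intro j hj z hz
    rw [hp, add_comm, sub_div, div_self hn0.ne', one_div]
    have := norm_sub_le_norm_add (((ρ : ℂ)⁻¹ * (z - w i)) ^ n) (1 : ℂ)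
    rw [norm_one] at this
    linarith [hout j hj z hz]
  have hp0 : ∀ z ∈ ⋃ i, Metric.closedBall (w i) (r i), p.eval z ≠ 0 := by
    intro z hz
    obtain ⟨j, hj⟩ := Set.mem_iUnion.1 hz
    rw [← norm_pos_iff]
    by_cases hji : j = i
    · subst hji
      linarith [hpin z hj]
    · exact (div_pos (by linarith) hn0).trans_le (hpout j hji z hj)
  have hcompl : IsPreconnected (⋃ i, Metric.closedBall (w i) (r i))ᶜ := by
    simpa using isPreconnected_compl_biUnion_closedBall Finset.univ w r hr hd
  obtain ⟨φ, hφ, hφp⟩ := exists_inv_mem_topologicalClosure hcompl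
    ⟨w i, Set.mem_iUnion.2 ⟨i, Metric.mem_closedBall_self hri⟩⟩ p hp0
  refine ⟨φ, hφ, fun x => ⟨fun hx => ?_, fun j hj hx => ?_⟩⟩
  · have h0 : p.eval (x : ℂ) ≠ 0 := hp0 x x.2
    have h1 : φ x - 1 = -((ρ : ℂ)⁻¹ * (x - w i)) ^ n / p.eval (x : ℂ) := by
      rw [hφp, eq_div_iff h0, sub_mul, inv_mul_cancel₀ h0, hp]
      ring
    rw [h1, norm_div, norm_neg, div_le_iff₀ (norm_pos_iff.2 h0)]
    calc _ ≤ q ^ n := hin _ hx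
      _ ≤ ε * (1 - q ^ n) := hnε
      _ ≤ _ := by gcongr; exact hpin _ hx
  · rw [hφp, norm_inv]
    refine inv_le_of_inv_le₀ hε (le_trans ?_ (hpout j hj _ hx))
    rw [inv_le_iff_one_le_mul₀ hε, div_mul_eq_mul_div, one_le_div₀ hn0]
    linarith

/-- A form of Runge's theorem: entire functions prescribed independently on finitely many disjoint
closed discs are simultaneously approximated by one entire function. -/
theorem exists_entire_approx (hr : ∀ i, 0 ≤ r i)
    (hd : ∀ i j, i ≠ j → r i + r j < dist (w i) (w j)) (f : ι → ℂ → ℂ)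
    (hf : ∀ i, Differentiable ℂ (f i)) {ε : ℝ} (hε : 0 < ε) :
    ∃ g : ℂ → ℂ, Differentiable ℂ g ∧
      ∀ i, ∀ z ∈ Metric.closedBall (w i) (r i), ‖g z - f i z‖ < ε := by
  classical
  set K : Set ℂ := ⋃ i, Metric.closedBall (w i) (r i) with hK
  have hKc : IsCompact K := isCompact_iUnion_closedBall w r
  have : CompactSpace K := isCompact_iff_compactSpace.1 hKc
  obtain ⟨M, hM0, hM⟩ : ∃ M > 0, ∀ i, ∀ z ∈ K, ‖f i z‖ ≤ M := by
    choose M hM using fun i => hKc.exists_bound_of_continuousOn (hf i).continuous.continuousOn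
    refine ⟨∑ i, |M i| + 1, by positivity, fun i z hz => ?_⟩
    have h1 := Finset.single_le_sum (f := fun i => |M i|) (fun i _ => abs_nonneg _)
      (Finset.mem_univ i)
    linarith [hM i z hz, le_abs_self (M i)]
  set η := ε / 2 / (M * (Fintype.card ι + 1)) with hη
  have hη0 : 0 < η := by positivity
  choose φ hφ hφb using fun i => exists_approx_indicator hr hd i hη0
  let F : ι → C(K, ℂ) := fun i => ⟨fun x => f i x, by have := (hf i).continuous; fun_prop⟩
  have hmem : ∑ i, φ i * F i ∈ (entireRestrictions K).topologicalClosure :=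
    Subalgebra.sum_mem _ fun i _ => Subalgebra.mul_mem _ (hφ i)
      (Subalgebra.le_topologicalClosure _ ⟨f i, hf i, fun _ => rfl⟩)
  obtain ⟨G, ⟨g, hg, hgG⟩, hGd⟩ := Metric.mem_closure_iff.1 hmem (ε / 2) (by positivity)
  refine ⟨g, hg, fun i z hz => ?_⟩
  have hzK : z ∈ K := Set.mem_iUnion.2 ⟨i, hz⟩
  have h1 : ‖(∑ j, φ j * F j) ⟨z, hzK⟩ - g z‖ < ε / 2 := by
    rw [← hgG ⟨z, hzK⟩, ← dist_eq_norm]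
    exact (ContinuousMap.dist_apply_le_dist _).trans_lt hGd
  have h2 : ‖(∑ j, φ j * F j) ⟨z, hzK⟩ - f i z‖ ≤ ε / 2 := by
    have h3 : (∑ j, φ j * F j) ⟨z, hzK⟩ - f i z =
        ∑ j, (φ j ⟨z, hzK⟩ - if j = i then 1 else 0) * f j z := by
      simp only [ContinuousMap.coe_sum, Finset.sum_apply, ContinuousMap.mul_apply, sub_mul,
        Finset.sum_sub_distrib, ite_mul, one_mul, zero_mul, Finset.sum_ite_eq', Finset.mem_univ,
        if_true]
      rfl
    rw [h3]
    calc _ ≤ ∑ j : ι, η * M := by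
          refine norm_sum_le_of_le _ fun j _ => ?_
          rw [norm_mul]
          refine mul_le_mul ?_ (hM j z hzK) (norm_nonneg _) hη0.le
          by_cases hj : j = i
          · subst hj
            simpa using (hφb j ⟨z, hzK⟩).1 hz
          · simpa [hj] using (hφb j ⟨z, hzK⟩).2 i (Ne.symm hj) hz
      _ = Fintype.card ι * (η * M) := by simp
      _ ≤ (Fintype.card ι + 1) * (η * M) := by
          have : 0 < η * M := by positivity
          linarith
      _ = ε / 2 := by rw [hη]; field_simp
  calc ‖g z - f i z‖ ≤ ‖g z - (∑ j, φ j * F j) ⟨z, hzK⟩‖ + ‖(∑ j, φ j * F j) ⟨z, hzK⟩ - f i z‖ :=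
        norm_sub_le_norm_sub_add_norm_sub _ _ _
    _ < ε := by rw [norm_sub_rev]; linarith

end Discs

/-! ### Moduli of the sequence and the covering of small discs -/

/-- If `i(Λ) = 1`, the moduli `|l n|` are eventually dense on the logarithmic scale. -/
lemma exists_norm_mem_Icc_of_ratioIndex {l : ℕ → ℂ} (hl0 : ∀ n, l n ≠ 0)
    (hl : Tendsto l atTop (cobounded ℂ)) (hi : ratioIndex l = 1) {ε : ℝ} (hε : 0 < ε) :
    ∃ X, ∀ x ≥ X, ∃ n, x ≤ ‖l n‖ ∧ ‖l n‖ ≤ (1 + ε) * x := by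
  have h1 : ratioIndex l < ((1 + ε : ℝ) : EReal) := by
    rw [hi, ← EReal.coe_one, EReal.coe_lt_coe_iff]; linarith
  obtain ⟨_, ⟨φ, hφ, rfl⟩, hlt⟩ := sInf_lt_iff.1 h1
  obtain ⟨N, hN⟩ := eventually_atTop.1 (eventually_lt_of_limsup_lt hlt)
  have hstep : ∀ n ≥ N, ‖l (φ (n + 1))‖ < (1 + ε) * ‖l (φ n)‖ := by
    intro n hn
    have := EReal.coe_lt_coe_iff.1 (hN n hn)
    rwa [norm_div, div_lt_iff₀ (norm_pos_iff.2 (hl0 _))] at this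
  have htend : Tendsto (fun n => ‖l (φ n)‖) atTop atTop :=
    tendsto_norm_cobounded_atTop.comp (hl.comp hφ.tendsto_atTop)
  refine ⟨‖l (φ N)‖, fun x hx => ?_⟩
  have hex : ∃ k, x ≤ ‖l (φ (N + k))‖ := by
    obtain ⟨k, hk1, hk2⟩ := ((htend.eventually_ge_atTop x).and (eventually_ge_atTop N)).exists
    exact ⟨k - N, by rwa [Nat.add_sub_cancel' hk2]⟩
  classical
  refine ⟨φ (N + Nat.find hex), Nat.find_spec hex, ?_⟩
  have hx0 : 0 ≤ x := (norm_nonneg _).trans hx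
  rcases h : Nat.find hex with _ | k
  · rw [add_zero]; nlinarith
  · have hk : ‖l (φ (N + k))‖ < x := not_le.1 (Nat.find_min hex (by omega))
    have := hstep (N + k) (by omega)
    rw [← add_assoc]
    nlinarith

/-- Every point of the plane is within `2 * h` of a point of the lattice `h ℤ[i]`. -/
lemma exists_lattice_point_near {h : ℝ} (hh : 0 < h) (a : ℂ) :
    ∃ p q : ℤ, ‖a - h * (p + q * Complex.I)‖ ≤ 2 * h := by
  refine ⟨⌊a.re / h⌋, ⌊a.im / h⌋, (Complex.norm_le_abs_re_add_abs_im _).trans ?_⟩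
  have key : ∀ x : ℝ, |x - h * ⌊x / h⌋| ≤ h := by
    intro x
    have h1 : x - h * ⌊x / h⌋ = h * Int.fract (x / h) := by
      rw [← Int.self_sub_floor]; field_simp
    rw [h1, abs_of_nonneg (mul_nonneg hh.le (Int.fract_nonneg _))]
    nlinarith [Int.fract_lt_one (x / h)]
  have h1 := key a.re
  have h2 := key a.im
  simp only [Complex.sub_re, Complex.sub_im, Complex.mul_re, Complex.mul_im, Complex.add_re,
    Complex.add_im, Complex.ofReal_re, Complex.ofReal_im, Complex.intCast_re, Complex.intCast_im,
    Complex.I_re, Complex.I_im]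
  norm_num
  linarith

/-- Two distinct lattice points of `ℤ[i]` which are congruent modulo `m` are at distance at
least `m`. -/
lemma le_norm_sub_of_congruent {m : ℕ} {p q p' q' : ℤ} (hp : (p : ZMod m) = p')
    (hq : (q : ZMod m) = q') (hne : (p, q) ≠ (p', q')) :
    (m : ℝ) ≤ ‖((p : ℂ) + q * Complex.I) - (p' + q' * Complex.I)‖ := by
  have key : ∀ s t : ℤ, (s : ZMod m) = t → s ≠ t → (m : ℝ) ≤ |((s - t : ℤ) : ℝ)| := by
    intro s t hst hne
    have hdvd : (m : ℤ) ∣ s - t := by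
      rw [← ZMod.intCast_eq_intCast_iff_dvd_sub]; exact hst.symm
    have := Int.le_of_dvd (abs_pos.2 (sub_ne_zero.2 hne)) ((dvd_abs _ _).2 hdvd)
    exact_mod_cast this
  by_cases h : p = p'
  · have hq' : q ≠ q' := fun h' => hne (by rw [h, h'])
    refine (key q q' hq hq').trans ((le_of_eq ?_).trans (Complex.abs_im_le_norm _))
    simp
  · refine (key p p' hp h).trans ((le_of_eq ?_).trans (Complex.abs_re_le_norm _))
    simp

/-- The covering lemma. Near a nonzero parameter `a₀` one finds finitely many centres, far from the
origin and far apart from each other, such that every parameter `a` of a fixed disc around `a₀`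
has some `l n * a` close to a centre. The parameters are approximated by a fine lattice, whose
points are distributed among finitely many congruence classes; each class is sparse, and is
scaled by its own `l n`. The moduli of these `l n` are so close together that the lattice
spacing remains appropriate, yet so distinct that different classes are sent to separated annuli. -/
theorem exists_covering {l : ℕ → ℂ}
    (hl : ∀ ε > 0, ∃ X, ∀ x ≥ X, ∃ n, x ≤ ‖l n‖ ∧ ‖l n‖ ≤ (1 + ε) * x)
    {a₀ : ℂ} (ha₀ : a₀ ≠ 0) (R : ℝ) {δ : ℝ} (hδ : 0 < δ) :
    ∃ η > 0, ∀ B : ℝ, ∃ T : Finset (ℤ × ℤ), ∃ w : ℤ × ℤ → ℂ, (∀ t ∈ T, B < ‖w t‖) ∧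
      (∀ t ∈ T, ∀ t' ∈ T, t ≠ t' → R < dist (w t) (w t')) ∧
      ∀ a ∈ Metric.closedBall a₀ η, ∃ n, ∃ t ∈ T, ‖l n * a - w t‖ ≤ δ := by
  -- `σ / x` is the lattice spacing for sequence terms of modulus between `x` and `2 * x`.
  set σ := δ / 4 with hσ
  have hσ0 : 0 < σ := by positivity
  obtain ⟨m, hm⟩ := exists_nat_gt (max (R / σ) 0)
  have hm0 : 0 < m := by exact_mod_cast (le_max_right _ _).trans_lt hm
  have hmR : R < σ * m := by
    have := (le_max_left _ _).trans_lt hm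
    rwa [div_lt_iff₀ hσ0, mul_comm] at this
  have : NeZero m := ⟨hm0.ne'⟩
  set M := Fintype.card (ZMod m × ZMod m) with hM
  have hM0 : 0 < (M : ℝ) := by exact_mod_cast Fintype.card_pos
  let e : ZMod m × ZMod m ≃ Fin M := Fintype.equivFin _
  have hA : 0 < ‖a₀‖ := norm_pos_iff.2 ha₀
  set η := ‖a₀‖ / (32 * M) with hη
  have hη0 : 0 < η := by positivity
  have hηM : η * (32 * M) = ‖a₀‖ := by rw [hη]; field_simp
  have hM1 : (1 : ℝ) ≤ M := by exact_mod_cast (Nat.cast_pos.1 hM0 : 0 < M)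
  refine ⟨η, hη0, fun B => ?_⟩
  obtain ⟨X, hX⟩ := hl (1 / (4 * M)) (by positivity)
  -- the scale `x` is taken large enough for all the finitely many constraints
  obtain ⟨x, hx⟩ : ∃ x : ℝ, X < x ∧ 0 < x ∧ 2 * σ < η * x ∧ B < 16 * η * x ∧ R < 8 * η * x := by
    have h1 : Tendsto (fun x : ℝ => η * x) atTop atTop := tendsto_id.const_mul_atTop hη0
    have h2 : Tendsto (fun x : ℝ => 16 * η * x) atTop atTop :=
      tendsto_id.const_mul_atTop (by positivity)
    have h3 : Tendsto (fun x : ℝ => 8 * η * x) atTop atTop :=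
      tendsto_id.const_mul_atTop (by positivity)
    exact ((eventually_gt_atTop X).and ((eventually_gt_atTop 0).and
      ((h1.eventually_gt_atTop _).and ((h2.eventually_gt_atTop _).and
        (h3.eventually_gt_atTop _))))).exists
  obtain ⟨hxX, hx0, hxσ, hxB, hxR⟩ := hx
  have hscale : ∀ j : Fin M, ∃ n, x * (1 + j / M) ≤ ‖l n‖ ∧
      ‖l n‖ ≤ x * (1 + j / M) + x / (2 * M) := by
    intro j
    have hj0 : (0 : ℝ) ≤ j / M := by positivity
    have hj1 : (j : ℝ) / M ≤ 1 := (div_le_one hM0).2 (by exact_mod_cast j.2.le)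
    obtain ⟨n, h1, h2⟩ := hX (x * (1 + j / M)) (by nlinarith)
    refine ⟨n, h1, h2.trans ?_⟩
    have : 1 / (4 * M) * (x * (1 + j / M)) ≤ 1 / (4 * M) * (x * 2) := by gcongr; linarith
    have h4 : 1 / (4 * (M : ℝ)) * (x * 2) = x / (2 * M) := by field_simp; norm_num
    linarith
  choose N hN1 hN2 using hscale
  have hNx : ∀ j, x ≤ ‖l (N j)‖ := by
    intro j
    have hj0 : (0 : ℝ) ≤ j / M := by positivity
    nlinarith [hN1 j]
  have hN2x : ∀ j, ‖l (N j)‖ ≤ 2 * x := by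
    intro j
    have hj1 : ((j : ℝ) + 1) / M ≤ 1 := (div_le_one hM0).2 (by exact_mod_cast j.2)
    have h1 : x / (2 * M) = x * (1 / M) / 2 := by field_simp
    have h2 : ((j : ℝ) + 1) / M = j / M + 1 / M := add_div _ _ _
    have h3 : 0 < x * (1 / (M : ℝ)) := by positivity
    nlinarith [hN2 j]
  have hNgap : ∀ j k : Fin M, j < k → ‖l (N j)‖ + x / (2 * M) ≤ ‖l (N k)‖ := by
    intro j k hjk
    have h1 : ((j : ℝ) + 1) / M ≤ k / M := by
      gcongr
      exact_mod_cast hjk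
    have h2 : ((j : ℝ) + 1) / M = j / M + 1 / M := add_div _ _ _
    have h3 : x / (2 * M) = x * (1 / M) / 2 := by field_simp
    have h4 : x * (j / M + 1 / M) ≤ x * (k / M) := by rw [← h2]; gcongr
    nlinarith [hN2 j, hN1 k]
  set h := σ / x with hh
  have hh0 : 0 < h := by positivity
  have hhx : h * x = σ := by rw [hh]; field_simp
  have hhη : 2 * h ≤ η := by
    by_contra hc
    nlinarith
  let g : ℤ × ℤ → ℂ := fun t => h * (t.1 + t.2 * Complex.I)
  let cls : ℤ × ℤ → Fin M := fun t => e ((t.1 : ZMod m), (t.2 : ZMod m))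
  have hfin : {t : ℤ × ℤ | ‖g t - a₀‖ ≤ 2 * η}.Finite := by
    obtain ⟨P, hP⟩ := exists_nat_gt ((‖a₀‖ + 2 * η) / h)
    rw [div_lt_iff₀ hh0] at hP
    refine ((Set.finite_Icc (-(P : ℤ)) P).prod (Set.finite_Icc (-(P : ℤ)) P)).subset ?_
    intro t ht
    have h1 : ‖g t‖ < P * h := by
      have := norm_le_norm_add_norm_sub' (g t) a₀
      have ht' : ‖g t - a₀‖ ≤ 2 * η := ht
      linarith
    have h2 : ‖g t‖ = h * ‖(t.1 + t.2 * Complex.I : ℂ)‖ := by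
      simp only [g]
      rw [norm_mul, Complex.norm_real, Real.norm_of_nonneg hh0.le]
    have h3 : ‖(t.1 + t.2 * Complex.I : ℂ)‖ < P := by
      by_contra hc
      nlinarith
    have h4 := (Complex.abs_re_le_norm (t.1 + t.2 * Complex.I : ℂ)).trans_lt h3
    have h5 := (Complex.abs_im_le_norm (t.1 + t.2 * Complex.I : ℂ)).trans_lt h3
    simp only [Complex.add_re, Complex.add_im, Complex.mul_re, Complex.mul_im, Complex.intCast_re,
      Complex.intCast_im, Complex.I_re, Complex.I_im] at h4 h5
    norm_num at h4 h5
    rw [abs_lt] at h4 h5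
    exact ⟨⟨by exact_mod_cast h4.1.le, by exact_mod_cast h4.2.le⟩,
      ⟨by exact_mod_cast h5.1.le, by exact_mod_cast h5.2.le⟩⟩
  have hT : ∀ t, t ∈ hfin.toFinset ↔ ‖g t - a₀‖ ≤ 2 * η := fun t => by simp
  have hglow : ∀ t ∈ hfin.toFinset, ‖a₀‖ - 2 * η ≤ ‖g t‖ := by
    intro t ht
    have := norm_le_norm_add_norm_sub (g t) a₀
    linarith [(hT t).1 ht]
  have hgup : ∀ t ∈ hfin.toFinset, ‖g t‖ ≤ ‖a₀‖ + 2 * η := by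
    intro t ht
    have := norm_le_norm_add_norm_sub' (g t) a₀
    linarith [(hT t).1 ht]
  have hAη : 32 * η ≤ ‖a₀‖ := by rw [← hηM]; nlinarith
  have hcross : ∀ t ∈ hfin.toFinset, ∀ t' ∈ hfin.toFinset, cls t < cls t' →
      R < dist (l (N (cls t)) * g t) (l (N (cls t')) * g t') := by
    intro t ht t' ht' hlt
    have h1 := norm_sub_norm_le (l (N (cls t')) * g t') (l (N (cls t)) * g t)
    rw [norm_mul _ (g t'), norm_mul _ (g t)] at h1
    rw [dist_comm, dist_eq_norm]
    have h2 : ‖l (N (cls t'))‖ * (‖a₀‖ - 2 * η) ≤ ‖l (N (cls t'))‖ * ‖g t'‖ := by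
      gcongr; exact hglow t' ht'
    have h3 : ‖l (N (cls t))‖ * ‖g t‖ ≤ ‖l (N (cls t))‖ * (‖a₀‖ + 2 * η) := by
      gcongr; exact hgup t ht
    have h4 := hNgap _ _ hlt
    have h5 : x / (2 * M) * ‖a₀‖ = 16 * η * x := by rw [← hηM]; field_simp; norm_num
    have h6 := mul_le_mul_of_nonneg_right (hN2x (cls t)) hη0.le
    have h7 := mul_le_mul_of_nonneg_right (hN2x (cls t')) hη0.le
    have h8 := mul_le_mul_of_nonneg_right h4 hA.le
    linarith
  refine ⟨hfin.toFinset, fun t => l (N (cls t)) * g t, ?_, ?_, ?_⟩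
  · intro t ht
    rw [norm_mul]
    have h1 := hglow t ht
    have h2 := hNx (cls t)
    have h3 : x * (16 * η) ≤ ‖l (N (cls t))‖ * ‖g t‖ := by
      gcongr; linarith
    linarith
  · intro t ht t' ht' hne
    rcases lt_trichotomy (cls t) (cls t') with hlt | heq | hlt
    · exact hcross t ht t' ht' hlt
    · have hc := e.injective heq
      rw [Prod.mk.injEq] at hc
      have hm' := le_norm_sub_of_congruent hc.1 hc.2 hne
      change R < dist (l (N (cls t)) * g t) (l (N (cls t')) * g t')
      rw [← heq, dist_eq_norm, ← mul_sub]
      simp only [g]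
      rw [← mul_sub, norm_mul, norm_mul, Complex.norm_real, Real.norm_of_nonneg hh0.le]
      calc R < σ * m := hmR
        _ = x * (h * m) := by rw [← hhx]; ring
        _ ≤ _ := by gcongr; exact hNx _
    · rw [dist_comm]
      exact hcross t' ht' t ht hlt
  · intro a ha
    obtain ⟨p, q, hpq⟩ := exists_lattice_point_near hh0 a
    rw [mem_closedBall_iff_norm] at ha
    refine ⟨N (cls (p, q)), (p, q), (hT _).2 ?_, ?_⟩
    · have h1 : ‖g (p, q) - a‖ ≤ 2 * h := by rw [norm_sub_rev]; exact hpq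
      have := norm_sub_le_norm_sub_add_norm_sub (g (p, q)) a a₀
      linarith
    · rw [← mul_sub, norm_mul]
      calc _ ≤ 2 * x * (2 * h) := by gcongr; exact hN2x _
        _ = δ := by rw [show 2 * x * (2 * h) = 4 * (h * x) by ring, hhx, hσ]; ring

/-! ### The space of entire functions and the Baire category argument -/

lemma isClosed_entireFunctions : IsClosed (EntireFunctions : Set C(ℂ, ℂ)) := by
  refine isClosed_of_closure_subset fun f hf => ?_
  obtain ⟨u, hu, hlim⟩ := mem_closure_iff_seq_limit.1 hf
  rw [ContinuousMap.tendsto_iff_tendstoLocallyUniformly] at hlim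
  exact differentiableOn_univ.1 ((tendstoLocallyUniformlyOn_univ.2 hlim).differentiableOn
    (Eventually.of_forall fun n => (hu n).differentiableOn) isOpen_univ)

instance : BaireSpace EntireFunctions := by
  have : CompleteSpace EntireFunctions := isClosed_entireFunctions.completeSpace_coe
  have : IsCountablyGenerated (uniformity EntireFunctions) :=
    Filter.comap.isCountablyGenerated _ _
  infer_instance

instance : SecondCountableTopology EntireFunctions :=
  TopologicalSpace.Subtype.secondCountableTopology (EntireFunctions : Set C(ℂ, ℂ))

lemma exists_forall_norm_sub_lt_mem {h : EntireFunctions} {V : Set EntireFunctions}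
    (hV : V ∈ 𝓝 h) : ∃ ρ > 0, ∃ ε > 0, ∀ φ : EntireFunctions,
      (∀ z, ‖z‖ ≤ ρ → ‖φ.1 z - h.1 z‖ < ε) → φ ∈ V := by
  obtain ⟨U, hU, hUV⟩ := mem_nhds_subtype _ _ _ |>.1 hV
  obtain ⟨⟨K, ε⟩, ⟨hK, hε⟩, hsub⟩ := (nhds_basis_uniformity'
    Metric.uniformity_basis_dist.compactConvergenceUniformity).mem_iff.1 hU
  obtain ⟨ρ, hρ⟩ := hK.isBounded.subset_closedBall 0
  refine ⟨max ρ 1, by positivity, ε, hε, fun φ hφ => hUV (hsub fun z hz => ?_)⟩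
  have h1 : ‖z‖ ≤ ρ := by simpa using hρ hz
  have := hφ z (h1.trans (le_max_left _ _))
  rwa [← dist_eq_norm, dist_comm] at this

lemma continuous_translationOp_uncurry :
    Continuous fun p : EntireFunctions × ℂ => translationOp p.2 p.1 := by
  refine Continuous.subtype_mk ?_ _
  let τ : C(ℂ, C(ℂ, ℂ)) := ContinuousMap.curry ⟨fun p => p.2 + p.1, by fun_prop⟩
  exact (continuous_subtype_val.comp continuous_fst).compCM (τ.continuous.comp continuous_snd)

/-- The entire functions `f` such that, for every parameter `a ∈ S`, some translate
`f (· + l n * a)` belongs to `V`. -/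
def visiting (l : ℕ → ℂ) (S : Set ℂ) (V : Set EntireFunctions) : Set EntireFunctions :=
  {f | ∀ a ∈ S, ∃ n, translationOp (l n * a) f ∈ V}

lemma isOpen_visiting (l : ℕ → ℂ) {S : Set ℂ} (hS : IsCompact S) {V : Set EntireFunctions}
    (hV : IsOpen V) : IsOpen (visiting l S V) := by
  rw [isOpen_iff_mem_nhds]
  intro f hf
  refine hS.eventually_forall_of_forall_eventually
    (P := fun f a => ∃ n, translationOp (l n * a) f ∈ V) fun a ha => ?_
  obtain ⟨n, hn⟩ := hf a ha
  have hc : Continuous fun p : EntireFunctions × ℂ => translationOp (l n * p.2) p.1 :=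
    continuous_translationOp_uncurry.comp (by fun_prop :
      Continuous fun p : EntireFunctions × ℂ => (p.1, l n * p.2))
  filter_upwards [(hV.preimage hc).mem_nhds hn] with p hp
  exact ⟨n, hp⟩

/-- Every nonzero parameter has a disc around it on which visiting a given nonempty open set is a
generic property: a given function on a large disc and copies of the target centred at the points
of `exists_covering` are approximated simultaneously by `exists_entire_approx`. -/
theorem exists_dense_visiting {l : ℕ → ℂ}
    (hl : ∀ ε > 0, ∃ X, ∀ x ≥ X, ∃ n, x ≤ ‖l n‖ ∧ ‖l n‖ ≤ (1 + ε) * x)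
    {a₀ : ℂ} (ha₀ : a₀ ≠ 0) {V : Set EntireFunctions} (hV : IsOpen V) (hne : V.Nonempty) :
    ∃ η > 0, Dense (visiting l (Metric.closedBall a₀ η) V) := by
  obtain ⟨h, hh⟩ := hne
  obtain ⟨ρ, hρ, ε, hε, hVε⟩ := exists_forall_norm_sub_lt_mem (hV.mem_nhds hh)
  obtain ⟨δ', hδ', huc⟩ := Metric.uniformContinuousOn_iff.1
    ((isCompact_closedBall (0 : ℂ) (ρ + 1)).uniformContinuousOn_of_continuous
      h.1.continuous.continuousOn) (ε / 2) (by positivity)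
  set δ := min (δ' / 2) 1 with hδ
  have hδ0 : 0 < δ := by positivity
  obtain ⟨η, hη, hcov⟩ := exists_covering hl ha₀ (2 * (ρ + 1)) hδ0
  refine ⟨η, hη, fun g => mem_closure_iff_nhds.2 fun U hU => ?_⟩
  obtain ⟨B, hB, ε', hε', hUε⟩ := exists_forall_norm_sub_lt_mem hU
  obtain ⟨T, w, hwB, hwd, hT⟩ := hcov (B + (ρ + 1))
  -- the disc around the origin is indexed by `none`
  let c : Option T → ℂ := fun i => i.elim 0 fun t => w t
  let r : Option T → ℝ := fun i => i.elim B fun _ => ρ + 1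
  let F : Option T → ℂ → ℂ := fun i => i.elim g.1 fun t z => h.1 (z - w t)
  have hdis : ∀ i j, i ≠ j → r i + r j < dist (c i) (c j) := by
    rintro (_ | ⟨t, ht⟩) (_ | ⟨t', ht'⟩) hij
    · exact absurd rfl hij
    · simpa [r, c] using hwB t' ht'
    · simpa [r, c, add_comm] using hwB t ht
    · have := hwd t ht t' ht' fun h => hij (by simp [h])
      simp only [r, c, Option.elim_some]
      linarith
  obtain ⟨f, hf, hfF⟩ := exists_entire_approx (w := c) (r := r)
    (by rintro (_ | t) <;> simp only [r, Option.elim] <;> positivity) hdis F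
    (by
      rintro (_ | t)
      · exact g.2
      · exact h.2.comp (differentiable_id.sub_const _))
    (lt_min hε' (half_pos hε))
  refine ⟨⟨⟨f, hf.continuous⟩, hf⟩, hUε _ fun z hz => ?_, fun a ha => ?_⟩
  · exact (hfF none z (by simpa [c, r] using hz)).trans_le (min_le_left _ _)
  · obtain ⟨n, t, ht, hnt⟩ := hT a ha
    refine ⟨n, hVε _ fun z hz => ?_⟩
    have hδ1 : δ ≤ 1 := min_le_right _ _
    have hδ2 : δ < δ' := (min_le_left _ _).trans_lt (half_lt_self hδ')
    have hz' : z + l n * a - w t = z + (l n * a - w t) := by ring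
    have hzt : ‖z + l n * a - w t‖ ≤ ρ + 1 := by
      rw [hz']
      exact (norm_add_le _ _).trans (by linarith)
    have h1 : ‖f (z + l n * a) - h.1 (z + l n * a - w t)‖ < ε / 2 :=
      (hfF (some ⟨t, ht⟩) (z + l n * a)
        (by simpa [c, r, dist_eq_norm] using hzt)).trans_le (min_le_right _ _)
    have h2 : ‖h.1 (z + l n * a - w t) - h.1 z‖ < ε / 2 := by
      rw [← dist_eq_norm]
      refine huc _ (by simpa using hzt) _ (by simpa using hz.trans (by linarith)) ?_
      rw [dist_eq_norm, hz', add_sub_cancel_left]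
      linarith
    calc ‖f (z + l n * a) - h.1 z‖
        ≤ ‖f (z + l n * a) - h.1 (z + l n * a - w t)‖ + ‖h.1 (z + l n * a - w t) - h.1 z‖ :=
          norm_sub_le_norm_sub_add_norm_sub _ _ _
      _ < ε := by linarith

lemma visiting_anti (l : ℕ → ℂ) {S S' : Set ℂ} (h : S ⊆ S') (V : Set EntireFunctions) :
    visiting l S' V ⊆ visiting l S V :=
  fun _ hf a ha => hf a (h ha)

/-- All nonzero parameters are handled by countably many compact discs avoiding the origin, each as
in `exists_dense_visiting`. -/
lemma isGδ_and_dense_visiting {l : ℕ → ℂ}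
    (hl : ∀ ε > 0, ∃ X, ∀ x ≥ X, ∃ n, x ≤ ‖l n‖ ∧ ‖l n‖ ≤ (1 + ε) * x)
    {V : Set EntireFunctions} (hV : IsOpen V) (hne : V.Nonempty) :
    IsGδ (visiting l {a | a ≠ 0} V) ∧ Dense (visiting l {a | a ≠ 0} V) := by
  have hdisc : ∀ a : ℂ, a ≠ 0 → ∃ η > 0, Metric.closedBall a η ⊆ {a | a ≠ 0} ∧
      Dense (visiting l (Metric.closedBall a η) V) := by
    intro a ha
    obtain ⟨η, hη, hd⟩ := exists_dense_visiting hl ha hV hne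
    have ha' : 0 < ‖a‖ := norm_pos_iff.2 ha
    refine ⟨min η (‖a‖ / 2), by positivity, ?_, hd.mono (visiting_anti l
      (Metric.closedBall_subset_closedBall (min_le_left _ _)) V)⟩
    rintro _ hz rfl
    have : ‖a‖ ≤ ‖a‖ / 2 := by simpa using (Metric.mem_closedBall.1 hz).trans (min_le_right _ _)
    linarith
  choose! η hη0 hηsub hηd using hdisc
  obtain ⟨t, hts, htc, htU⟩ := TopologicalSpace.countable_cover_nhdsWithin (s := {a : ℂ | a ≠ 0})
    (f := fun a => Metric.closedBall a (η a))
    (fun a ha => mem_nhdsWithin_of_mem_nhds (Metric.closedBall_mem_nhds a (hη0 a ha)))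
  have heq : visiting l {a | a ≠ 0} V = ⋂ a ∈ t, visiting l (Metric.closedBall a (η a)) V := by
    refine Set.Subset.antisymm
      (Set.subset_iInter₂ fun a ha => visiting_anti l (hηsub a (hts ha)) V) fun f hf a ha => ?_
    obtain ⟨b, hb, hab⟩ := Set.mem_iUnion₂.1 (htU ha)
    exact Set.mem_iInter₂.1 hf b hb a hab
  have ho : ∀ a ∈ t, IsOpen (visiting l (Metric.closedBall a (η a)) V) := fun a _ =>
    isOpen_visiting l (isCompact_closedBall _ _) hV
  rw [heq]
  exact ⟨IsGδ.biInter_of_isOpen htc ho, dense_biInter_of_isOpen ho htc fun a ha => hηd a (hts ha)⟩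

lemma iInter_HC_eq_iInter_visiting (l : ℕ → ℂ) :
    (⋂ a ∈ {a : ℂ | a ≠ 0}, HC (fun n => translationOp (l n * a))) =
      ⋂ V ∈ TopologicalSpace.countableBasis EntireFunctions, visiting l {a | a ≠ 0} V := by
  ext f
  simp only [Set.mem_iInter]
  constructor
  · intro hf V hV a ha
    have hd : Dense {y | ∃ n, y = translationOp (l n * a) f} := dense_iff_closure_eq.2 (hf a ha)
    obtain ⟨_, hy, n, rfl⟩ := hd.inter_open_nonempty V
      (TopologicalSpace.isOpen_of_mem_countableBasis hV)
      (TopologicalSpace.nonempty_of_mem_countableBasis hV)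
    exact ⟨n, hy⟩
  · intro hf a ha
    refine dense_iff_closure_eq.1
      ((TopologicalSpace.isBasis_countableBasis _).dense_iff.2 fun V hV _ => ?_)
    obtain ⟨n, hn⟩ := hf V hV a ha
    exact ⟨_, hn, n, rfl⟩

theorem theorem1 (l : ℕ → ℂ) (hl0 : ∀ n, l n ≠ 0) (hl : Tendsto l atTop (cobounded ℂ))
    (hi : ratioIndex l = 1) :
    IsGδ (⋂ a ∈ {a : ℂ | a ≠ 0}, HC (fun n => translationOp (l n * a))) ∧
    Dense (⋂ a ∈ {a : ℂ | a ≠ 0}, HC (fun n => translationOp (l n * a))) ∧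
    ∃ f : EntireFunctions, ∀ a : ℂ, a ≠ 0 →
      closure {g : EntireFunctions | ∃ n, ∀ z, g.1 z = f.1 (z + l n * a)} = Set.univ := by
  have hvis : ∀ V ∈ TopologicalSpace.countableBasis EntireFunctions,
      IsGδ (visiting l {a | a ≠ 0} V) ∧ Dense (visiting l {a | a ≠ 0} V) := fun V hV =>
    isGδ_and_dense_visiting (fun ε hε => exists_norm_mem_Icc_of_ratioIndex hl0 hl hi hε)
      (TopologicalSpace.isOpen_of_mem_countableBasis hV)
      (TopologicalSpace.nonempty_of_mem_countableBasis hV)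
  have hdense : Dense (⋂ a ∈ {a : ℂ | a ≠ 0}, HC (fun n => translationOp (l n * a))) := by
    rw [iInter_HC_eq_iInter_visiting]
    exact dense_biInter_of_Gδ (fun V hV => (hvis V hV).1)
      (TopologicalSpace.countable_countableBasis _) fun V hV => (hvis V hV).2
  refine ⟨?_, hdense, ?_⟩
  · rw [iInter_HC_eq_iInter_visiting]
    exact IsGδ.biInter (TopologicalSpace.countable_countableBasis _) fun V hV => (hvis V hV).1
  · obtain ⟨f, hf⟩ := hdense.nonempty
    refine ⟨f, fun a ha => ?_⟩
    rw [← show closure {y | ∃ n, y = translationOp (l n * a) f} = Set.univ from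
      Set.mem_iInter₂.1 hf a ha]
    congr 1
    ext g
    refine exists_congr fun n => ⟨fun h => Subtype.ext (ContinuousMap.ext h), ?_⟩
    rintro rfl z
    rfl
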